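/- Let $\mathcal X$ be a Polish space with its Borel $\sigma$-algebra, let $\gamma$ be a measure on $\mathcal X$, and let $I:\mathcal X\to[0,\infty]$ have compact sublevel sets $\{I\le M\}$, $M\in[0,\infty)$. Assume that for every $\varepsilon\in(0,\infty)$ $$\mu^{\varepsilon}(dx)=\frac1{Z^{\varepsilon}}e^{-I(x)/\varepsilon}\gamma(dx),\qquad Z^{\varepsilon}=\int_{\mathcal X} e^{-I(x)/\varepsilon}\,\gamma(dx),$$ is a well-defined probability measure (that is, $0<Z^\varepsilon<\infty$; here $e^{-\infty}=0$), and that $\{\mu^\varepsilon\}$ satisfies, as $\varepsilon\downarrow0$, the large deviation principle with scaling $\varepsilon$ and rate function $I$: $\limsup_{\varepsilon\to0}\varepsilon\log\mu^\varepsilon(C)\le-\inf_C I$ for every closed $C$ and $\liminf_{\varepsilon\to0}\varepsilon\log\mu^\varepsilon(U)\ge-\inf_U I$ for every open $U$. Assume that $I$ is continuous on $\{I<\infty\}$, and let $F:\mathcal X\to\mathbb R$ be continuous and bounded below. Let $K\ge1$ and let $\boldsymbol\alpha=(\alpha_1,\dots,\alpha_K)$ satisfy $1=\alpha_1\ge\alpha_2\ge\cdots\ge\alpha_K\ge0$.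 For each $\varepsilon>0$ let $X_1^\varepsilon,\dots,X_K^\varepsilon$ be independent with $X_j^\varepsilon\sim\mu^{\varepsilon/\alpha_j}$; if $\alpha_j=0$, then $\mu^{\varepsilon/\alpha_j}=\mu^{\infty}$ is the normalized reference measure $\gamma/\gamma(\mathcal X)$, and it is then understood that $\gamma(\mathcal X)<\infty$. Let $\Sigma_K$ be the set of permutations of $\{1,\dots,K\}$, write $\mathbf x_\sigma=(x_{\sigma(1)},\dots,x_{\sigma(K)})$, and define (with $0\cdot\infty=0$) the weights and the $K$-temperature INS estimator by $$\rho^\varepsilon(\mathbf x;\boldsymbol\alpha)=\frac{e^{-\frac1\varepsilon\sum_{j=1}^K\alpha_jI(x_j)}}{\sum_{\tau\in\Sigma_K}e^{-\frac1\varepsilon\sum_{j=1}^K\alpha_jI(x_{\tau(j)})}},\qquad \hat\eta^\varepsilon(\mathbf x;\boldsymbol\alpha)=\sum_{\sigma\in\Sigma_K}\rho^\varepsilon(\mathbf x_\sigma;\boldsymbol\alpha)\,e^{-\frac1\varepsilon F(x_{\sigma(1)})}.$$ Let $D=\{(I(x),F(x)):x\in\mathcal X\}$ and $$V_F(\boldsymbol\alpha)=\inf\Big[2\sum_{j=1}^K\alpha_jI_j+2f-\min_{\sigma\in\Sigma_K}\sum_{j=1}^K\alpha_jI_{\sigma(j)}\Big],$$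 the infimum being over all $(I_1,f)\in D$ with $I_1<\infty$ and all $I_2,\dots,I_K\in[0,I_1]$. Then $$\lim_{\varepsilon\to0}-\varepsilon\log E\Big[\big(\hat\eta^\varepsilon(\mathbf X^\varepsilon;\boldsymbol\alpha)\big)^2\Big]=V_F(\boldsymbol\alpha).$$ -/

import Mathlib

open MeasureTheory ProbabilityTheory Filter Topology
open scoped ENNReal NNReal

namespace INS

/-- `exp (-y)` for `y ∈ [0, ∞]`, with `exp (-∞) = 0`. -/
noncomputable def expNeg (y : ℝ≥0∞) : ℝ≥0∞ := EReal.exp (-(y : EReal))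

section Measures

variable {𝒳 : Type*} [MeasurableSpace 𝒳]

/-- The normalizing constant `Z^T = ∫ exp (-I / T) dγ` at temperature `T ∈ (0, ∞]`. -/
noncomputable def partitionFunction (γ : Measure 𝒳) (I : 𝒳 → ℝ≥0∞) (T : ℝ≥0∞) : ℝ≥0∞ :=
  ∫⁻ x, expNeg (I x / T) ∂γ

/-- The measure `μ^T (dx) = (1 / Z^T) exp (-I x / T) γ (dx)` at temperature `T ∈ (0, ∞]`.
At `T = ∞` it is the normalized reference measure `γ / γ(𝒳)`. It is a probability measure exactly
when `0 < Z^T < ∞`, and the zero measure otherwise. -/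
noncomputable def gibbsMeasure (γ : Measure 𝒳) (I : 𝒳 → ℝ≥0∞) (T : ℝ≥0∞) : Measure 𝒳 :=
  (partitionFunction γ I T)⁻¹ • γ.withDensity (fun x => expNeg (I x / T))

/-- The family `(μ ε)` for `ε > 0` satisfies the large deviation principle with scaling `ε` and
rate function `I`: `I` has compact sublevel sets, and the upper bound for closed sets and the
lower bound for open sets hold as `ε ↓ 0`. -/
structure SatisfiesLDP [TopologicalSpace 𝒳] (μ : ℝ → Measure 𝒳) (I : 𝒳 → ℝ≥0∞) : Prop where
  isCompact_sublevel : ∀ M : ℝ≥0, IsCompact {x | I x ≤ (M : ℝ≥0∞)}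
  upper_bound : ∀ C : Set 𝒳, IsClosed C →
    limsup (fun ε : ℝ => (ε : EReal) * ENNReal.log (μ ε C)) (𝓝[>] 0)
      ≤ -(⨅ x ∈ C, (I x : EReal))
  lower_bound : ∀ U : Set 𝒳, IsOpen U →
    -(⨅ x ∈ U, (I x : EReal))
      ≤ liminf (fun ε : ℝ => (ε : EReal) * ENNReal.log (μ ε U)) (𝓝[>] 0)

/-- The measures `μ^ε (dx) = (1 / Z^ε) exp (-I x / ε) γ (dx)`, `ε ∈ (0, ∞)`, are well-defined
probability measures and satisfy the large deviation principle with rate function `I`. -/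
structure GibbsLDP [TopologicalSpace 𝒳] (γ : Measure 𝒳) (I : 𝒳 → ℝ≥0∞) : Prop where
  isProbabilityMeasure : ∀ ε : ℝ, 0 < ε →
    IsProbabilityMeasure (gibbsMeasure γ I (ENNReal.ofReal ε))
  ldp : SatisfiesLDP (fun ε => gibbsMeasure γ I (ENNReal.ofReal ε)) I

end Measures

section Estimator

variable {𝒳 : Type*} {K : ℕ}

/-- `∑ j, α_j I (x_j)`, with the convention `0 * ∞ = 0`. -/
noncomputable def energy (I : 𝒳 → ℝ≥0∞) (α : Fin K → ℝ≥0) (x : Fin K → 𝒳) : ℝ≥0∞ :=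
  ∑ j, (α j : ℝ≥0∞) * I (x j)

/-- The weight `ρ^ε (x; α)`. -/
noncomputable def weight (I : 𝒳 → ℝ≥0∞) (α : Fin K → ℝ≥0) (ε : ℝ) (x : Fin K → 𝒳) : ℝ≥0∞ :=
  expNeg (energy I α x / ENNReal.ofReal ε) /
    ∑ τ : Equiv.Perm (Fin K), expNeg (energy I α (fun j => x (τ j)) / ENNReal.ofReal ε)

/-- The single-sample INS estimator
`η^ε (x; α) = ∑ σ, ρ^ε (x_σ; α) exp (-F (x_σ(1)) / ε)`. The index `0 : Fin K` is the first one. -/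
noncomputable def estimator [NeZero K] (I : 𝒳 → ℝ≥0∞) (F : 𝒳 → ℝ) (α : Fin K → ℝ≥0) (ε : ℝ)
    (x : Fin K → 𝒳) : ℝ≥0∞ :=
  ∑ σ : Equiv.Perm (Fin K),
    weight I α ε (fun j => x (σ j)) * ENNReal.ofReal (Real.exp (-F (x (σ 0)) / ε))

/-- The set `D` of all pairs `(I x, F x)`. -/
def valuePairs (I : 𝒳 → ℝ≥0∞) (F : 𝒳 → ℝ) : Set (ℝ≥0∞ × ℝ) :=
  Set.range fun x => (I x, F x)

/-- The expression minimized in the definition of the decay rate: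
`2 ∑ j, α_j J_j + 2 f - min_σ ∑ j, α_j J_σ(j)`. -/
noncomputable def objective (α J : Fin K → ℝ≥0) (f : ℝ) : ℝ :=
  2 * ∑ j, (α j : ℝ) * (J j : ℝ) + 2 * f
    - Finset.univ.inf' Finset.univ_nonempty
        (fun σ : Equiv.Perm (Fin K) => ∑ j, (α j : ℝ) * (J (σ j) : ℝ))

/-- The decay rate `V_F (α)`: the infimum of `objective α J f` over all `(J_1, f) ∈ D` with `J_1`
finite and all `J_j ∈ [0, J_1]`, `j ≥ 2`. -/
noncomputable def decayRate [NeZero K] (I : 𝒳 → ℝ≥0∞) (F : 𝒳 → ℝ) (α : Fin K → ℝ≥0) : EReal :=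
  ⨅ (J : Fin K → ℝ≥0) (f : ℝ) (_ : ((J 0 : ℝ≥0∞), f) ∈ valuePairs I F) (_ : ∀ j, J j ≤ J 0),
    (objective α J f : EReal)

end Estimator

end INS

/-!
For a configuration `x` of finite energy `E = ∑ j, α_j I (x_j)`, let `M` be the least energy of its
rearrangements. Up to the factor `K!`, the weight of `x` is `exp (-(E - M) / ε)` and the estimator
is the largest term `exp (-(E - M + F (x_1)) / ε)` over the rearrangements of `x`. The joint law
contributes another `exp (-E / ε)`, or `exp (-M / ε)` after rearranging `x`, so the second moment
decays at the rate `inf (2E + 2F (x_1) - M)`.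

This infimum is `V_F (α)`. For one inequality, replace each `I (x_j)` by `min (I (x_j)) (I (x_1))`:
the removed excesses lower `M` by at most as much as they lower `E`, because a single permutation,
sorting `I (x_j)` against `α`, minimizes the energy of the clipped values and of the excesses at
the same time. For the other, the values `J_j ∈ [0, J_1]` in `V_F (α)` need not be attained by `I`;
but on vectors in a fixed order the objective is linear, so averaging over thresholds replaces
them by values in `{0, J_1}`, which are attained at a zero of `I` and at `x_1`.

The exponent need not be continuous where `I` is infinite, so the upper bound is a direct integral
estimate rather than an application of Varadhan's lemma: an arbitrarily small share of the exponent
is spent on integrability, which then costs only ratios of partition functions.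
-/

namespace INS

section Exponentials

lemma expNeg_antitone : Antitone expNeg := fun _ _ hab =>
  EReal.exp_monotone (EReal.neg_le_neg_iff.2 (EReal.coe_ennreal_le_coe_ennreal_iff.2 hab))

lemma measurable_expNeg : Measurable expNeg := expNeg_antitone.measurable

@[simp] lemma expNeg_zero : expNeg 0 = 1 := by simp [expNeg]

@[simp] lemma expNeg_top : expNeg ∞ = 0 := by simp [expNeg]

lemma expNeg_add (a b : ℝ≥0∞) : expNeg (a + b) = expNeg a * expNeg b := by
  rw [expNeg, EReal.coe_ennreal_add, EReal.neg_add (.inl (EReal.coe_ennreal_ne_bot a))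
    (.inr (EReal.coe_ennreal_ne_bot b)), sub_eq_add_neg, EReal.exp_add, expNeg, expNeg]

lemma expNeg_sum {ι : Type*} (s : Finset ι) (f : ι → ℝ≥0∞) :
    expNeg (∑ i ∈ s, f i) = ∏ i ∈ s, expNeg (f i) := by
  classical
  induction s using Finset.induction_on with
  | empty => simp
  | insert a s ha ih => rw [Finset.sum_insert ha, Finset.prod_insert ha, expNeg_add, ih]

/-- The factor `exp (-t / ε)` as an extended nonnegative real: the finite, possibly negative
energies `t` are the exponential rates in which integrals are estimated as `ε ↓ 0`. -/
noncomputable def boltzmann (ε t : ℝ) : ℝ≥0∞ := ENNReal.ofReal (Real.exp (-t / ε))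

variable {ε : ℝ}

lemma boltzmann_ne_zero (ε t : ℝ) : boltzmann ε t ≠ 0 := by simp [boltzmann, Real.exp_pos]

lemma boltzmann_ne_top (ε t : ℝ) : boltzmann ε t ≠ ∞ := ENNReal.ofReal_ne_top

lemma boltzmann_add (ε s t : ℝ) : boltzmann ε (s + t) = boltzmann ε s * boltzmann ε t := by
  rw [boltzmann, boltzmann, boltzmann, ← ENNReal.ofReal_mul (Real.exp_nonneg _), ← Real.exp_add]
  ring_nf

lemma boltzmann_neg (ε t : ℝ) : boltzmann ε (-t) = (boltzmann ε t)⁻¹ := by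
  rw [boltzmann, boltzmann, ← ENNReal.ofReal_inv_of_pos (Real.exp_pos _), ← Real.exp_neg]
  ring_nf

lemma boltzmann_sub (ε s t : ℝ) : boltzmann ε (s - t) = boltzmann ε s / boltzmann ε t := by
  rw [sub_eq_add_neg, boltzmann_add, boltzmann_neg, ENNReal.div_eq_inv_mul, mul_comm]

lemma boltzmann_pow (ε t : ℝ) (n : ℕ) : boltzmann ε t ^ n = boltzmann ε (n * t) := by
  rw [boltzmann, boltzmann, ← ENNReal.ofReal_pow (Real.exp_nonneg _), ← Real.exp_nat_mul]
  ring_nf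

lemma boltzmann_antitone (hε : 0 ≤ ε) : Antitone (boltzmann ε) := fun s t hst =>
  ENNReal.ofReal_le_ofReal (Real.exp_le_exp.2 (by gcongr))

lemma expNeg_div_ofReal (hε : 0 < ε) {t : ℝ≥0∞} (ht : t ≠ ∞) :
    expNeg (t / ENNReal.ofReal ε) = boltzmann ε t.toReal := by
  lift t to ℝ≥0 using ht
  lift ε to ℝ≥0 using hε.le
  have hε0 : ε ≠ 0 := (NNReal.coe_pos.1 hε).ne'
  rw [ENNReal.ofReal_coe_nnreal, ← ENNReal.coe_div hε0, expNeg, boltzmann, ← EReal.exp_coe,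
    ENNReal.coe_toReal, neg_div, EReal.coe_neg, ← NNReal.coe_div]
  rfl

lemma eventually_mul_boltzmann_le {C : ℝ≥0∞} (hC : C ≠ ∞) {r s : ℝ} (h : r < s) :
    ∀ᶠ ε : ℝ in 𝓝[>] 0, C * boltzmann ε s ≤ boltzmann ε r := by
  have hlim : Tendsto (fun ε : ℝ => Real.exp ((s - r) / ε)) (𝓝[>] 0) atTop := by
    simp only [div_eq_mul_inv]
    exact Real.tendsto_exp_atTop.comp (tendsto_inv_nhdsGT_zero.const_mul_atTop (sub_pos.2 h))
  filter_upwards [hlim.eventually_ge_atTop C.toReal] with ε hε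
  calc C * boltzmann ε s
    _ ≤ boltzmann ε (r - s) * boltzmann ε s := by
        gcongr
        rw [boltzmann, neg_sub, ← ENNReal.ofReal_toReal hC]
        exact ENNReal.ofReal_le_ofReal hε
    _ = boltzmann ε r := by rw [← boltzmann_add, sub_add_cancel]

lemma neg_mul_log_boltzmann (hε : 0 < ε) (r : ℝ) :
    -(ε : EReal) * ENNReal.log (boltzmann ε r) = r := by
  rw [boltzmann, ← EReal.exp_coe, EReal.log_exp, ← EReal.coe_neg, ← EReal.coe_mul]
  congr 1
  field_simp

lemma neg_mul_log_antitone (hε : 0 ≤ ε) :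
    Antitone fun q : ℝ≥0∞ => -(ε : EReal) * ENNReal.log q := fun p q hpq => by
  simp only [EReal.neg_mul, EReal.neg_le_neg_iff]
  exact mul_le_mul_of_nonneg_left (ENNReal.log_monotone hpq) (by exact_mod_cast hε)

lemma tendsto_neg_mul_log {Q : ℝ → ℝ≥0∞} {v : EReal}
    (hupper : ∀ r : ℝ, (r : EReal) < v →
      ∃ C ≠ ∞, ∀ᶠ ε : ℝ in 𝓝[>] 0, Q ε ≤ C * boltzmann ε r)
    (hlower : ∀ r : ℝ, v < r → ∃ c ≠ 0, ∀ᶠ ε : ℝ in 𝓝[>] 0, c * boltzmann ε r ≤ Q ε) :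
    Tendsto (fun ε : ℝ => -(ε : EReal) * ENNReal.log (Q ε)) (𝓝[>] 0) (𝓝 v) := by
  refine tendsto_order.2 ⟨fun a ha => ?_, fun a ha => ?_⟩
  · obtain ⟨r, har, hrv⟩ := EReal.exists_between_coe_real ha
    obtain ⟨s, hrs, hsv⟩ := EReal.exists_between_coe_real hrv
    obtain ⟨C, hC, hQ⟩ := hupper s hsv
    filter_upwards [hQ, eventually_mul_boltzmann_le hC (EReal.coe_lt_coe_iff.1 hrs),
      self_mem_nhdsWithin] with ε hQε hCε hε
    rw [← neg_mul_log_boltzmann hε r] at har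
    exact har.trans_le (neg_mul_log_antitone (le_of_lt hε) (hQε.trans hCε))
  · obtain ⟨r, hvr, hra⟩ := EReal.exists_between_coe_real ha
    obtain ⟨s, hvs, hsr⟩ := EReal.exists_between_coe_real hvr
    obtain ⟨c, hc, hQ⟩ := hlower s hvs
    filter_upwards [hQ, eventually_mul_boltzmann_le (ENNReal.inv_ne_top.2 hc)
      (EReal.coe_lt_coe_iff.1 hsr), self_mem_nhdsWithin] with ε hQε hcε hε
    rw [← neg_mul_log_boltzmann hε r] at hra
    refine (neg_mul_log_antitone (le_of_lt hε) (le_trans ?_ hQε)).trans_lt hra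
    by_cases hctop : c = ∞
    · simp [hctop, boltzmann_ne_zero]
    · rwa [← ENNReal.div_eq_inv_mul, ENNReal.div_le_iff_le_mul (.inl hc) (.inl hctop),
        mul_comm] at hcε

end Exponentials

section Rearrangement

variable {K : ℕ} {𝒳 : Type*} {I : 𝒳 → ℝ≥0∞} {α : Fin K → ℝ≥0}

lemma exists_antivary_comp_perm {β γ : Type*} [LinearOrder β] [LinearOrder γ] (f : Fin K → β)
    (g : Fin K → γ) : ∃ σ : Equiv.Perm (Fin K), Antivary f (g ∘ σ) := by
  let π := Tuple.sort (OrderDual.toDual ∘ f)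
  have hf : Antitone (f ∘ π) := Tuple.monotone_sort (OrderDual.toDual ∘ f)
  have hg : Monotone (g ∘ Tuple.sort g) := Tuple.monotone_sort g
  refine ⟨π.symm.trans (Tuple.sort g), fun i j hij => ?_⟩
  simpa using hf.antivary hg (i := π.symm i) (j := π.symm j) hij

lemma energy_comp_perm_le_of_ne_top (hI : ∀ y, I y ≠ ∞) {x : Fin K → 𝒳}
    {σ : Equiv.Perm (Fin K)} (hσ : Antivary α (I ∘ x ∘ σ)) (τ : Equiv.Perm (Fin K)) :
    energy I α (x ∘ σ) ≤ energy I α (x ∘ τ) := by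
  lift I to 𝒳 → ℝ≥0 using hI
  have h : Antivary α (I ∘ x ∘ σ) := fun i j hij => hσ (ENNReal.coe_lt_coe.2 hij)
  have := h.sum_mul_le_sum_mul_comp_perm (σ := σ⁻¹ * τ)
  simpa [energy, ← ENNReal.coe_mul, ← ENNReal.ofNNReal_finsetSum] using this

lemma energy_comp_perm_le {x : Fin K → 𝒳} {σ : Equiv.Perm (Fin K)}
    (hσ : Antivary α (I ∘ x ∘ σ)) (τ : Equiv.Perm (Fin K)) :
    energy I α (x ∘ σ) ≤ energy I α (x ∘ τ) := by
  have htrunc (π : Equiv.Perm (Fin K)) : Tendsto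
      (fun n : ℕ => energy (fun y => min (I y) n) α (x ∘ π)) atTop (𝓝 (energy I α (x ∘ π))) := by
    refine tendsto_finsetSum _ fun j _ => ENNReal.Tendsto.const_mul ?_ (.inr ENNReal.coe_ne_top)
    simpa using (tendsto_const_nhds (x := I (x (π j)))).min ENNReal.tendsto_nat_nhds_top
  refine le_of_tendsto_of_tendsto' (htrunc σ) (htrunc τ) fun n => ?_
  refine energy_comp_perm_le_of_ne_top (fun y => by simp) ?_ τ
  exact fun i j h => hσ ((monotone_id.min monotone_const).reflect_lt h)

/-- The smallest energy `min_σ ∑ j, α_j I (x_σ(j))` over all rearrangements of `x`. -/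
noncomputable def minEnergy (I : 𝒳 → ℝ≥0∞) (α : Fin K → ℝ≥0) (x : Fin K → 𝒳) : ℝ≥0∞ :=
  ⨅ σ : Equiv.Perm (Fin K), energy I α (x ∘ σ)

lemma minEnergy_le_energy_comp (I : 𝒳 → ℝ≥0∞) (α : Fin K → ℝ≥0) (x : Fin K → 𝒳)
    (σ : Equiv.Perm (Fin K)) : minEnergy I α x ≤ energy I α (x ∘ σ) :=
  iInf_le _ σ

lemma minEnergy_le_energy (I : 𝒳 → ℝ≥0∞) (α : Fin K → ℝ≥0) (x : Fin K → 𝒳) :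
    minEnergy I α x ≤ energy I α x :=
  minEnergy_le_energy_comp I α x 1

lemma exists_energy_comp_eq_minEnergy (I : 𝒳 → ℝ≥0∞) (α : Fin K → ℝ≥0) (x : Fin K → 𝒳) :
    ∃ σ : Equiv.Perm (Fin K), energy I α (x ∘ σ) = minEnergy I α x :=
  exists_eq_ciInf_of_finite

lemma minEnergy_comp_perm (I : 𝒳 → ℝ≥0∞) (α : Fin K → ℝ≥0) (x : Fin K → 𝒳)
    (σ : Equiv.Perm (Fin K)) : minEnergy I α (x ∘ σ) = minEnergy I α x :=
  (Equiv.mulLeft σ).iInf_comp (g := fun τ : Equiv.Perm (Fin K) => energy I α (x ∘ τ))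

lemma minEnergy_eq_of_antivary {x : Fin K → 𝒳} {σ : Equiv.Perm (Fin K)}
    (hσ : Antivary α (I ∘ x ∘ σ)) : minEnergy I α x = energy I α (x ∘ σ) :=
  le_antisymm (minEnergy_le_energy_comp I α x σ) (le_iInf (energy_comp_perm_le hσ))

lemma energy_eq_energy_min_add_energy_sub (I : 𝒳 → ℝ≥0∞) (α : Fin K → ℝ≥0) (c : ℝ≥0∞)
    (x : Fin K → 𝒳) :
    energy I α x = energy (fun y => min (I y) c) α x + energy (fun y => I y - c) α x := by
  simp only [energy, ← Finset.sum_add_distrib, ← mul_add]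
  refine Finset.sum_congr rfl fun j _ => ?_
  rcases le_total (I (x j)) c with h | h
  · rw [min_eq_left h, tsub_eq_zero_of_le h, add_zero]
  · rw [min_eq_right h, add_tsub_cancel_of_le h]

lemma minEnergy_le_minEnergy_min_add_energy_sub (I : 𝒳 → ℝ≥0∞) (α : Fin K → ℝ≥0) (c : ℝ≥0∞)
    (x : Fin K → 𝒳) :
    minEnergy I α x ≤ minEnergy (fun y => min (I y) c) α x + energy (fun y => I y - c) α x := by
  obtain ⟨σ, hσ⟩ := exists_antivary_comp_perm α (I ∘ x)
  have hmin : Antivary α ((fun y => min (I y) c) ∘ x ∘ σ) :=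
    fun i j h => hσ ((monotone_id.min monotone_const).reflect_lt h)
  have hsub : Antivary α ((fun y => I y - c) ∘ x ∘ σ) :=
    fun i j h => hσ (Monotone.reflect_lt (fun _ _ => (tsub_le_tsub_right · c)) h)
  calc minEnergy I α x
    _ = energy (fun y => min (I y) c) α (x ∘ σ) + energy (fun y => I y - c) α (x ∘ σ) := by
        rw [minEnergy_eq_of_antivary hσ, energy_eq_energy_min_add_energy_sub]
    _ ≤ minEnergy (fun y => min (I y) c) α x + energy (fun y => I y - c) α x := by
        rw [← minEnergy_eq_of_antivary hmin]
        gcongr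
        exact energy_comp_perm_le hsub 1

end Rearrangement

section Cost

variable {K : ℕ} {𝒳 : Type*} {I : 𝒳 → ℝ≥0∞} {F : 𝒳 → ℝ} {α : Fin K → ℝ≥0}

lemma energy_ne_top {x : Fin K → 𝒳} (hx : ∀ j, I (x j) ≠ ∞) : energy I α x ≠ ∞ :=
  ENNReal.sum_ne_top.2 fun j _ => ENNReal.mul_ne_top ENNReal.coe_ne_top (hx j)

lemma objective_eq_of_antivary {J : Fin K → ℝ≥0} {σ : Equiv.Perm (Fin K)}
    (hσ : Antivary α (J ∘ σ)) (f : ℝ) :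
    objective α J f = 2 * f + ∑ j, (2 * (α j : ℝ) - α (σ.symm j)) * J j := by
  have hmin : Finset.univ.inf' Finset.univ_nonempty
      (fun τ : Equiv.Perm (Fin K) => ∑ j, (α j : ℝ) * (J (τ j) : ℝ))
        = ∑ j, (α j : ℝ) * J (σ j) := by
    refine le_antisymm (Finset.inf'_le _ (Finset.mem_univ σ)) (Finset.le_inf' _ _ fun τ _ => ?_)
    exact_mod_cast show ∑ j, α j * J (σ j) ≤ ∑ j, α j * J (τ j) by
      simpa using hσ.sum_mul_le_sum_mul_comp_perm (σ := τ.trans σ.symm)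
  have hsymm : ∑ j, (α (σ.symm j) : ℝ) * J j = ∑ j, (α j : ℝ) * J (σ j) := by
    simpa using (Equiv.sum_comp σ fun j => (α (σ.symm j) : ℝ) * J j).symm
  simp only [objective, hmin, ← hsymm, sub_mul, mul_assoc, Finset.sum_sub_distrib, Finset.mul_sum]
  ring

-- `∫ t in 0..b, 1_{t < J j} = J j`, so some `t` does at most as well as the average over `[0, b)`.
lemma exists_threshold_sum_le {ι : Type*} [Fintype ι] (c J : ι → ℝ) {b : ℝ} (hJ0 : ∀ j, 0 ≤ J j)
    (hJb : ∀ j, J j ≤ b) (hb : 0 ≤ b) :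
    ∃ t < b, ∑ j, c j * (if t < J j then b else 0) ≤ ∑ j, c j * J j := by
  rcases hb.eq_or_lt with rfl | hb
  · have hJ (j : ι) : J j = 0 := le_antisymm (hJb j) (hJ0 j)
    exact ⟨-1, by norm_num, by simp [hJ]⟩
  have hlayer (j : ι) : (fun t : ℝ => if t < J j then b else 0)
      = (Set.Iio (J j)).indicator fun _ => b := by
    ext t
    simp [Set.indicator_apply]
  have hint (j : ι) : IntegrableOn (fun t : ℝ => c j * if t < J j then b else 0) (Set.Ico 0 b) := by
    refine Integrable.const_mul ?_ _
    rw [hlayer]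
    exact (integrableOn_const (by simp)).indicator measurableSet_Iio
  have havg (j : ι) : ∫ t in Set.Ico 0 b, c j * (if t < J j then b else 0) = b * (c j * J j) := by
    rw [integral_const_mul, hlayer, setIntegral_indicator measurableSet_Iio, Set.Ico_inter_Iio,
      min_eq_right (hJb j), setIntegral_const, Real.volume_real_Ico_of_le (hJ0 j), sub_zero,
      smul_eq_mul]
    ring
  obtain ⟨t, ht, hle⟩ := exists_le_setAverage (by simpa using hb) (by simp)
    (integrable_finsetSum Finset.univ fun j _ => hint j)
  refine ⟨t, ht.2, hle.trans_eq ?_⟩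
  rw [setAverage_eq, integral_finsetSum _ fun j _ => hint j, Real.volume_real_Ico_of_le hb.le,
    sub_zero, smul_eq_mul]
  simp only [havg, ← Finset.mul_sum]
  exact inv_mul_cancel_left₀ hb.ne' _

lemma exists_objective_vertex_le [NeZero K] (α : Fin K → ℝ≥0) {J : Fin K → ℝ≥0}
    (hJ : ∀ j, J j ≤ J 0) (f : ℝ) :
    ∃ J' : Fin K → ℝ≥0, J' 0 = J 0 ∧ (∀ j, J' j = 0 ∨ J' j = J 0) ∧
      objective α J' f ≤ objective α J f := by
  obtain ⟨σ, hσ⟩ := exists_antivary_comp_perm α J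
  obtain ⟨t, ht, hle⟩ := exists_threshold_sum_le (fun j => 2 * (α j : ℝ) - α (σ.symm j))
    (fun j => J j) (fun j => NNReal.coe_nonneg _) (fun j => NNReal.coe_le_coe.2 (hJ j))
    (NNReal.coe_nonneg _)
  let φ : ℝ≥0 → ℝ≥0 := fun s => if t < s then J 0 else 0
  have hφ : Monotone φ := by
    intro s s' hs
    dsimp only [φ]
    split_ifs with h h'
    exacts [le_rfl, absurd (h.trans_le (NNReal.coe_le_coe.2 hs)) h', zero_le, le_rfl]
  have hσφ : Antivary α ((φ ∘ J) ∘ σ) := fun i j h => hσ (hφ.reflect_lt h)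
  refine ⟨φ ∘ J, if_pos ht, fun j => ?_, ?_⟩
  · exact (ite_eq_or_eq (t < J j) (J 0) 0).symm
  · rw [objective_eq_of_antivary hσφ, objective_eq_of_antivary hσ]
    simpa [φ, apply_ite] using hle

/-- The exponential rate at which a configuration `x` of finite energy contributes to the second
moment of the estimator: `objective` at `J j = I (x j)` and `f = F (x 0)`. -/
noncomputable def cost [NeZero K] (I : 𝒳 → ℝ≥0∞) (F : 𝒳 → ℝ) (α : Fin K → ℝ≥0) (x : Fin K → 𝒳) :
    ℝ :=
  2 * (energy I α x).toReal + 2 * F (x 0) - (minEnergy I α x).toReal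

variable [NeZero K]

lemma cost_eq_objective {x : Fin K → 𝒳} {J : Fin K → ℝ≥0} (hJ : ∀ j, I (x j) = J j) :
    cost I F α x = objective α J (F (x 0)) := by
  have henergy (σ : Equiv.Perm (Fin K)) :
      energy I α (x ∘ σ) = ((∑ j, α j * J (σ j) : ℝ≥0) : ℝ≥0∞) := by
    simp [energy, hJ]
  have hmin : (minEnergy I α x).toReal = Finset.univ.inf' Finset.univ_nonempty
      (fun σ : Equiv.Perm (Fin K) => ∑ j, (α j : ℝ) * (J (σ j) : ℝ)) := by
    rw [minEnergy, ENNReal.toReal_iInf fun σ => by rw [henergy]; exact ENNReal.coe_ne_top,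
      Finset.inf'_univ_eq_ciInf]
    simp only [henergy, ENNReal.coe_toReal, NNReal.coe_sum, NNReal.coe_mul]
  have hone : (energy I α x).toReal = ∑ j, (α j : ℝ) * J j := by
    simpa [← ENNReal.coe_mul, ← ENNReal.ofNNReal_finsetSum]
      using congrArg ENNReal.toReal (henergy 1)
  rw [cost, objective, hmin, hone]

lemma cost_min_le_cost (I : 𝒳 → ℝ≥0∞) (F : 𝒳 → ℝ) (α : Fin K → ℝ≥0) (c : ℝ≥0∞) {x : Fin K → 𝒳}
    (hx : energy I α x ≠ ∞) : cost (fun y => min (I y) c) F α x ≤ cost I F α x := by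
  have hsplit := energy_eq_energy_min_add_energy_sub I α c x
  have hmin := minEnergy_le_minEnergy_min_add_energy_sub I α c x
  obtain ⟨hclip, hexc⟩ := ENNReal.add_ne_top.1 (hsplit ▸ hx)
  have hmclip := ne_top_of_le_ne_top hclip (minEnergy_le_energy _ α x)
  have hsplit' := congrArg ENNReal.toReal hsplit
  have hmin' := ENNReal.toReal_mono (ENNReal.add_ne_top.2 ⟨hmclip, hexc⟩) hmin
  rw [ENNReal.toReal_add hclip hexc] at hsplit'
  rw [ENNReal.toReal_add hmclip hexc] at hmin'
  have hnonneg : 0 ≤ (energy (fun y => I y - c) α x).toReal := ENNReal.toReal_nonneg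
  simp only [cost]
  linarith

lemma decayRate_le_cost (hα : α 0 ≠ 0) {x : Fin K → 𝒳} (hx : energy I α x ≠ ∞) :
    decayRate I F α ≤ cost I F α x := by
  have hx0 : I (x 0) ≠ ∞ := fun h =>
    ENNReal.sum_ne_top.1 hx 0 (Finset.mem_univ 0) (by simp [h, hα])
  let J : Fin K → ℝ≥0 := fun j => (min (I (x j)) (I (x 0))).toNNReal
  have hJ (j : Fin K) : min (I (x j)) (I (x 0)) = J j :=
    (ENNReal.coe_toNNReal (ne_top_of_le_ne_top hx0 (min_le_right _ _))).symm
  have hJ0 : (J 0 : ℝ≥0∞) = I (x 0) := by rw [← hJ, min_self]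
  calc decayRate I F α
    _ ≤ objective α J (F (x 0)) := by
        refine iInf₂_le_of_le J (F (x 0)) (iInf₂_le_of_le ⟨x 0, ?_⟩ (fun j => ?_) le_rfl)
        · rw [hJ0]
        · rw [← ENNReal.coe_le_coe, ← hJ, hJ0]
          exact min_le_right _ _
    _ = cost (fun y => min (I y) (I (x 0))) F α x := by rw [cost_eq_objective hJ]
    _ ≤ cost I F α x := EReal.coe_le_coe_iff.2 (cost_min_le_cost I F α _ hx)

lemma exists_cost_lt {z : 𝒳} (hz : I z = 0) {r : ℝ} (hr : decayRate I F α < r) :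
    ∃ x : Fin K → 𝒳, (∀ j, I (x j) ≠ ∞) ∧ cost I F α x < r := by
  simp only [decayRate, iInf_lt_iff] at hr
  obtain ⟨J, f, ⟨a, ha⟩, hJ, hlt⟩ := hr
  obtain ⟨hIa, rfl⟩ := Prod.mk.inj ha
  obtain ⟨J', hJ'0, hJ', hle⟩ := exists_objective_vertex_le α hJ (F a)
  have hpoint (j : Fin K) : ∃ y, I y = J' j ∧ (j = 0 → y = a) := by
    rcases hJ' j with h | h
    · by_cases hj : j = 0
      · exact ⟨a, by rw [hj, hJ'0, hIa], fun _ => rfl⟩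
      · exact ⟨z, by simp [h, hz], fun h0 => absurd h0 hj⟩
    · exact ⟨a, by rw [h, hIa], fun _ => rfl⟩
  choose x hx hxa using hpoint
  refine ⟨x, fun j => by simp [hx], ?_⟩
  rw [cost_eq_objective hx, hxa 0 rfl]
  exact hle.trans_lt (EReal.coe_lt_coe_iff.1 hlt)

end Cost

section Pinching

variable {K : ℕ} {𝒳 : Type*} {I : 𝒳 → ℝ≥0∞} {F : 𝒳 → ℝ} {α : Fin K → ℝ≥0} {ε : ℝ}

lemma div_div_coe {T : ℝ≥0∞} (hT : T ≠ 0) (a : ℝ≥0) (y : ℝ≥0∞) : y / (T / a) = a * y / T := by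
  simp only [div_eq_mul_inv, ENNReal.mul_inv (.inl hT) (.inr (ENNReal.inv_ne_zero.2
    ENNReal.coe_ne_top)), inv_inv]
  ring

lemma energy_div_ofReal (hε : 0 < ε) (I : 𝒳 → ℝ≥0∞) (α : Fin K → ℝ≥0) (x : Fin K → 𝒳) :
    energy I α x / ENNReal.ofReal ε = ∑ j, I (x j) / (ENNReal.ofReal ε / α j) := by
  have hε0 : ENNReal.ofReal ε ≠ 0 := by simpa using hε
  simp only [energy, div_div_coe hε0]
  simp only [div_eq_mul_inv, Finset.sum_mul]

lemma expNeg_minEnergy_le_sum (I : 𝒳 → ℝ≥0∞) (α : Fin K → ℝ≥0) (ε : ℝ) (x : Fin K → 𝒳) :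
    expNeg (minEnergy I α x / ENNReal.ofReal ε)
      ≤ ∑ σ : Equiv.Perm (Fin K), expNeg (energy I α (x ∘ σ) / ENNReal.ofReal ε) := by
  obtain ⟨σ, hσ⟩ := exists_energy_comp_eq_minEnergy I α x
  rw [← hσ]
  exact Finset.single_le_sum_of_canonicallyOrdered
    (f := fun σ : Equiv.Perm (Fin K) => expNeg (energy I α (x ∘ σ) / ENNReal.ofReal ε))
    (Finset.mem_univ σ)

lemma sum_expNeg_energy_le (I : 𝒳 → ℝ≥0∞) (α : Fin K → ℝ≥0) (ε : ℝ) (x : Fin K → 𝒳) :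
    ∑ σ : Equiv.Perm (Fin K), expNeg (energy I α (x ∘ σ) / ENNReal.ofReal ε)
      ≤ K.factorial * expNeg (minEnergy I α x / ENNReal.ofReal ε) := by
  calc _
    _ ≤ ∑ _σ : Equiv.Perm (Fin K), expNeg (minEnergy I α x / ENNReal.ofReal ε) :=
        Finset.sum_le_sum fun σ _ =>
          expNeg_antitone (ENNReal.div_le_div_right (minEnergy_le_energy_comp I α x σ) _)
    _ = _ := by simp [Fintype.card_perm]

lemma boltzmann_energy_sub_minEnergy (hε : 0 < ε) {x : Fin K → 𝒳} (hx : energy I α x ≠ ∞) :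
    boltzmann ε ((energy I α x).toReal - (minEnergy I α x).toReal)
      = expNeg (energy I α x / ENNReal.ofReal ε)
        / expNeg (minEnergy I α x / ENNReal.ofReal ε) := by
  rw [boltzmann_sub, expNeg_div_ofReal hε hx,
    expNeg_div_ofReal hε (ne_top_of_le_ne_top hx (minEnergy_le_energy I α x))]

lemma weight_le (hε : 0 < ε) {x : Fin K → 𝒳} (hx : energy I α x ≠ ∞) :
    weight I α ε x ≤ boltzmann ε ((energy I α x).toReal - (minEnergy I α x).toReal) := by
  rw [boltzmann_energy_sub_minEnergy hε hx, weight]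
  exact ENNReal.div_le_div_left (expNeg_minEnergy_le_sum I α ε x) _

lemma le_weight (hε : 0 < ε) {x : Fin K → 𝒳} (hx : energy I α x ≠ ∞) :
    (K.factorial : ℝ≥0∞)⁻¹ * boltzmann ε ((energy I α x).toReal - (minEnergy I α x).toReal)
      ≤ weight I α ε x := by
  rw [boltzmann_energy_sub_minEnergy hε hx, weight, ENNReal.div_eq_inv_mul, ← mul_assoc,
    ← ENNReal.mul_inv (.inl (by simp [K.factorial_ne_zero])) (.inl (ENNReal.natCast_ne_top _)),
    ← ENNReal.div_eq_inv_mul]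
  exact ENNReal.div_le_div_left (sum_expNeg_energy_le I α ε x) _

lemma weight_of_energy_eq_top {x : Fin K → 𝒳} (hx : energy I α x = ∞) : weight I α ε x = 0 := by
  simp [weight, hx, ENNReal.top_div_of_ne_top]

variable [NeZero K]

lemma estimator_eq_sum (I : 𝒳 → ℝ≥0∞) (F : 𝒳 → ℝ) (α : Fin K → ℝ≥0) (ε : ℝ) (x : Fin K → 𝒳) :
    estimator I F α ε x
      = ∑ σ : Equiv.Perm (Fin K), weight I α ε (x ∘ σ) * boltzmann ε (F (x (σ 0))) :=
  rfl

lemma estimator_comp_perm (I : 𝒳 → ℝ≥0∞) (F : 𝒳 → ℝ) (α : Fin K → ℝ≥0) (ε : ℝ) (x : Fin K → 𝒳)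
    (τ : Equiv.Perm (Fin K)) : estimator I F α ε (x ∘ τ) = estimator I F α ε x := by
  simp only [estimator_eq_sum]
  exact Equiv.sum_comp (Equiv.mulLeft τ) fun σ : Equiv.Perm (Fin K) =>
    weight I α ε (x ∘ σ) * boltzmann ε (F (x (σ 0)))

lemma le_estimator (hε : 0 < ε) {x : Fin K → 𝒳} (hx : energy I α x ≠ ∞) :
    (K.factorial : ℝ≥0∞)⁻¹
        * boltzmann ε ((energy I α x).toReal - (minEnergy I α x).toReal + F (x 0))
      ≤ estimator I F α ε x := by
  calc (K.factorial : ℝ≥0∞)⁻¹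
        * boltzmann ε ((energy I α x).toReal - (minEnergy I α x).toReal + F (x 0))
    _ ≤ weight I α ε x * boltzmann ε (F (x 0)) := by
        rw [boltzmann_add, ← mul_assoc]
        gcongr
        exact le_weight hε hx
    _ ≤ estimator I F α ε x := by
        rw [estimator_eq_sum]
        simpa using Finset.single_le_sum_of_canonicallyOrdered (f := fun σ : Equiv.Perm (Fin K) =>
          weight I α ε (x ∘ σ) * boltzmann ε (F (x (σ 0)))) (Finset.mem_univ 1)

lemma estimator_le {t : ℝ} (hε : 0 < ε) {x : Fin K → 𝒳}
    (ht : ∀ σ : Equiv.Perm (Fin K), energy I α (x ∘ σ) ≠ ∞ →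
      t ≤ (energy I α (x ∘ σ)).toReal - (minEnergy I α x).toReal + F (x (σ 0))) :
    estimator I F α ε x ≤ K.factorial * boltzmann ε t := by
  have hterm (σ : Equiv.Perm (Fin K)) :
      weight I α ε (x ∘ σ) * boltzmann ε (F (x (σ 0))) ≤ boltzmann ε t := by
    by_cases hσ : energy I α (x ∘ σ) = ∞
    · simp [weight_of_energy_eq_top hσ]
    calc weight I α ε (x ∘ σ) * boltzmann ε (F (x (σ 0)))
      _ ≤ boltzmann ε ((energy I α (x ∘ σ)).toReal - (minEnergy I α x).toReal)
            * boltzmann ε (F (x (σ 0))) := by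
          gcongr
          simpa only [minEnergy_comp_perm] using weight_le hε hσ
      _ ≤ boltzmann ε t := by
          rw [← boltzmann_add]
          exact boltzmann_antitone hε.le (ht σ hσ)
  calc estimator I F α ε x
    _ ≤ ∑ _σ : Equiv.Perm (Fin K), boltzmann ε t := by
        rw [estimator_eq_sum]
        exact Finset.sum_le_sum fun σ _ => hterm σ
    _ = K.factorial * boltzmann ε t := by simp [Fintype.card_perm]

-- The `κ` share of the exponent uses that `cost` is at least `v`, the `θ` share only that the
-- weights are at most one; it is kept aside to make the Gibbs integrals converge.
lemma estimator_sq_le {v m κ θ : ℝ} (hε : 0 < ε) (hα : α 0 ≠ 0) (hv : v ≤ decayRate I F α)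
    (hm : ∀ y, m ≤ F y) (hκ : 0 ≤ κ) (hθ : 0 ≤ θ) (hκθ : κ + θ = 1) {x : Fin K → 𝒳}
    (hx : energy I α x ≠ ∞) :
    estimator I F α ε x ^ 2
      ≤ K.factorial ^ 2 * boltzmann ε (κ * (v - (energy I α x).toReal) + 2 * θ * m) := by
  have hM : (minEnergy I α x).toReal ≤ (energy I α x).toReal :=
    ENNReal.toReal_mono hx (minEnergy_le_energy I α x)
  have hest := estimator_le (F := F)
    (t := (κ * (v - (energy I α x).toReal) + 2 * θ * m) / 2) hε (x := x) fun σ hσ => by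
    have hcost : v ≤ cost I F α (x ∘ σ) :=
      EReal.coe_le_coe_iff.1 (hv.trans (decayRate_le_cost hα hσ))
    have hMσ : (minEnergy I α (x ∘ σ)).toReal ≤ (energy I α (x ∘ σ)).toReal :=
      ENNReal.toReal_mono hσ (minEnergy_le_energy I α _)
    rw [cost, minEnergy_comp_perm, Function.comp_apply] at hcost
    rw [minEnergy_comp_perm] at hMσ
    set w := 2 * ((energy I α (x ∘ σ)).toReal - (minEnergy I α x).toReal + F (x (σ 0)))
    have hκw : κ * (v - (energy I α x).toReal) ≤ κ * w :=
      mul_le_mul_of_nonneg_left (by linarith) hκ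
    have hθw : θ * (2 * m) ≤ θ * w :=
      mul_le_mul_of_nonneg_left (by linarith [hm (x (σ 0))]) hθ
    have hsum : κ * w + θ * w = w := by rw [← add_mul, hκθ, one_mul]
    linarith
  calc estimator I F α ε x ^ 2
    _ ≤ _ := pow_le_pow_left' hest 2
    _ = _ := by rw [mul_pow, boltzmann_pow]; push_cast; ring_nf

lemma estimator_sq_le_prod {v m : ℝ} {κ θ : ℝ≥0} (hε : 0 < ε) (hα : α 0 ≠ 0)
    (hv : v ≤ decayRate I F α) (hm : ∀ y, m ≤ F y) (hκ : κ ≠ 0) (hκθ : κ + θ = 1)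
    (x : Fin K → 𝒳) :
    estimator I F α ε x ^ 2 ≤ K.factorial ^ 2 * boltzmann ε (κ * v + 2 * θ * m)
      * ∏ j, (expNeg (κ * (I (x j) / (ENNReal.ofReal ε / α j))))⁻¹ := by
  have hprod : ∏ j, (expNeg (κ * (I (x j) / (ENNReal.ofReal ε / α j))))⁻¹
      = (expNeg (κ * energy I α x / ENNReal.ofReal ε))⁻¹ := by
    rw [mul_div_assoc, energy_div_ofReal hε, Finset.mul_sum, expNeg_sum,
      ENNReal.prod_inv_distrib fun i _ j _ _ => .inr ?_]
    exact ne_top_of_le_ne_top ENNReal.one_ne_top (expNeg_zero ▸ expNeg_antitone zero_le)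
  rw [hprod]
  by_cases hx : energy I α x = ∞
  · have hK : (K.factorial : ℝ≥0∞) ≠ 0 := by exact_mod_cast K.factorial_ne_zero
    simp [hx, hκ, hK, ENNReal.top_div_of_ne_top, ENNReal.mul_top, boltzmann_ne_zero]
  · rw [expNeg_div_ofReal hε (ENNReal.mul_ne_top ENNReal.coe_ne_top hx), ENNReal.toReal_mul,
      ENNReal.coe_toReal, ← boltzmann_neg, mul_assoc, ← boltzmann_add]
    have hκθ' : (κ : ℝ) + θ = 1 := by exact_mod_cast hκθ
    convert estimator_sq_le hε hα hv hm κ.coe_nonneg θ.coe_nonneg hκθ' hx using 3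
    ring

end Pinching

section LevelNeighborhoods

variable {K : ℕ} {𝒳 : Type*} {I : 𝒳 → ℝ≥0∞} {F : 𝒳 → ℝ} {α : Fin K → ℝ≥0} {d : ℝ≥0}

lemma energy_add_const (I : 𝒳 → ℝ≥0∞) (α : Fin K → ℝ≥0) (d : ℝ≥0) (x : Fin K → 𝒳) :
    energy (fun y => I y + d) α x = energy I α x + ((∑ j, α j) * d : ℝ≥0) := by
  simp [energy, mul_add, Finset.sum_add_distrib, Finset.sum_mul]

lemma energy_le_energy_add {x y : Fin K → 𝒳} (h : ∀ j, I (x j) ≤ I (y j) + d) :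
    energy I α x ≤ energy I α y + ((∑ j, α j) * d : ℝ≥0) := by
  rw [← energy_add_const]
  exact Finset.sum_le_sum fun j _ => mul_le_mul_right (h j) _

lemma minEnergy_le_minEnergy_add {x y : Fin K → 𝒳} (h : ∀ j, I (x j) ≤ I (y j) + d) :
    minEnergy I α x ≤ minEnergy I α y + ((∑ j, α j) * d : ℝ≥0) := by
  obtain ⟨σ, hσ⟩ := exists_energy_comp_eq_minEnergy I α y
  rw [← hσ]
  exact (minEnergy_le_energy_comp I α x σ).trans (energy_le_energy_add fun j => h (σ j))

/-- The points at which `I` is within `d` of `I a` and `F` is at most `F a + d`: the replicas are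
confined to such sets in the lower bound. Since `I` is only continuous on `{I < ∞}`, this is a
neighborhood of `a` relative to `{I < ∞}`, but not in general a neighborhood of `a`. -/
def levelNeighborhood (I : 𝒳 → ℝ≥0∞) (F : 𝒳 → ℝ) (d : ℝ≥0) (a : 𝒳) : Set 𝒳 :=
  {y | I a ≤ I y + d ∧ I y ≤ I a + d ∧ F y ≤ F a + d}

lemma le_estimator_of_mem_levelNeighborhood [NeZero K] {ε : ℝ} (hε : 0 < ε) {x y : Fin K → 𝒳}
    (hx : energy I α x ≠ ∞) (hy : ∀ j, y j ∈ levelNeighborhood I F d (x j)) :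
    (K.factorial : ℝ≥0∞)⁻¹ * boltzmann ε ((energy I α x).toReal - (minEnergy I α x).toReal
        + F (x 0) + (2 * ∑ j, α j + 1) * d)
      ≤ estimator I F α ε y := by
  have hE : energy I α y ≤ energy I α x + ((∑ j, α j) * d : ℝ≥0) :=
    energy_le_energy_add fun j => (hy j).2.1
  have hyfin : energy I α y ≠ ∞ :=
    ne_top_of_le_ne_top (ENNReal.add_ne_top.2 ⟨hx, ENNReal.coe_ne_top⟩) hE
  have hE' := ENNReal.toReal_le_add hE hx ENNReal.coe_ne_top
  have hM' := ENNReal.toReal_le_add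
    (minEnergy_le_minEnergy_add (α := α) fun j => (hy j).1)
    (ne_top_of_le_ne_top hyfin (minEnergy_le_energy I α y)) ENNReal.coe_ne_top
  have hF0 : F (y 0) ≤ F (x 0) + d := (hy 0).2.2
  refine le_trans ?_ (le_estimator hε hyfin)
  gcongr
  refine boltzmann_antitone hε.le ?_
  simp only [ENNReal.coe_toReal, NNReal.coe_mul, NNReal.coe_sum] at hE' hM'
  push_cast
  linarith

end LevelNeighborhoods

section Gibbs

variable {𝒳 : Type*} [MeasurableSpace 𝒳] {γ : Measure 𝒳} {I : 𝒳 → ℝ≥0∞} {T : ℝ≥0∞}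

lemma measurable_expNeg_div (hI : Measurable I) (T : ℝ≥0∞) :
    Measurable fun y => expNeg (I y / T) :=
  measurable_expNeg.comp (hI.div_const T)

lemma partitionFunction_mono : Monotone (partitionFunction γ I) := fun _ _ h =>
  lintegral_mono fun _ => expNeg_antitone (ENNReal.div_le_div_left h _)

lemma partitionFunction_ne_top [hprob : IsProbabilityMeasure (gibbsMeasure γ I T)] :
    partitionFunction γ I T ≠ ∞ := by
  intro h
  simpa [gibbsMeasure, h] using hprob.measure_univ

lemma expNeg_mul_measure_le_setLIntegral {A : Set 𝒳} (hA : MeasurableSet A) {b : ℝ≥0∞}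
    (hb : ∀ y ∈ A, I y / T ≤ b) : expNeg b * γ A ≤ ∫⁻ y in A, expNeg (I y / T) ∂γ := by
  rw [← setLIntegral_const]
  exact setLIntegral_mono' hA fun y hy => expNeg_antitone (hb y hy)

lemma le_partitionFunction {A : Set 𝒳} (hA : MeasurableSet A) {b : ℝ≥0∞}
    (hb : ∀ y ∈ A, I y / T ≤ b) : expNeg b * γ A ≤ partitionFunction γ I T :=
  (expNeg_mul_measure_le_setLIntegral hA hb).trans (setLIntegral_le_lintegral _ _)

lemma le_gibbsMeasure {A : Set 𝒳} (hA : MeasurableSet A) {b : ℝ≥0∞}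
    (hb : ∀ y ∈ A, I y / T ≤ b) :
    expNeg b * ((partitionFunction γ I T)⁻¹ * γ A) ≤ gibbsMeasure γ I T A := by
  rw [gibbsMeasure, Measure.smul_apply, withDensity_apply _ hA, smul_eq_mul, mul_left_comm]
  gcongr
  exact expNeg_mul_measure_le_setLIntegral hA hb

lemma lintegral_inv_expNeg_gibbsMeasure_le (hI : Measurable I) (hT : T ≠ 0) {κ θ : ℝ≥0}
    (hκθ : κ + θ = 1) :
    ∫⁻ y, (expNeg (κ * (I y / T)))⁻¹ ∂gibbsMeasure γ I T
      ≤ (partitionFunction γ I T)⁻¹ * partitionFunction γ I (T / θ) := by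
  have hmul (y : 𝒳) : expNeg (I y / T) * (expNeg (κ * (I y / T)))⁻¹ ≤ expNeg (I y / (T / θ)) := by
    have hsplit : I y / T = κ * (I y / T) + θ * (I y / T) := by
      rw [← add_mul, ← ENNReal.coe_add, hκθ, ENNReal.coe_one, one_mul]
    rw [div_div_coe hT, mul_div_assoc]
    nth_rw 1 [hsplit]
    rw [expNeg_add, mul_right_comm]
    exact mul_le_of_le_one_left' (ENNReal.mul_inv_le_one _)
  have hinv : Measurable fun y => (expNeg (κ * (I y / T)))⁻¹ :=
    (measurable_expNeg.comp ((hI.div_const T).const_mul _)).inv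
  rw [gibbsMeasure, lintegral_smul_measure, smul_eq_mul,
    lintegral_withDensity_eq_lintegral_mul _ (measurable_expNeg_div hI T) hinv]
  gcongr
  exact lintegral_mono hmul

end Gibbs

section LargeDeviations

variable {𝒳 : Type*} [TopologicalSpace 𝒳] [MeasurableSpace 𝒳] [T2Space 𝒳]
  {γ : Measure 𝒳} {I : 𝒳 → ℝ≥0∞} {μ : ℝ → Measure 𝒳}

lemma SatisfiesLDP.lowerSemicontinuous (h : SatisfiesLDP μ I) : LowerSemicontinuous I := by
  refine lowerSemicontinuous_iff_isClosed_preimage.2 fun M => ?_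
  induction M using ENNReal.recTopCoe with
  | top => simp
  | coe M => exact (h.isCompact_sublevel M).isClosed

lemma SatisfiesLDP.exists_eq_zero (h : SatisfiesLDP μ I)
    (hμ : ∀ᶠ ε in 𝓝[>] 0, IsProbabilityMeasure (μ ε)) : ∃ z, I z = 0 := by
  have hlog : (fun ε : ℝ => (ε : EReal) * ENNReal.log (μ ε Set.univ)) =ᶠ[𝓝[>] 0] fun _ => 0 := by
    filter_upwards [hμ] with ε hε
    simp
  have hinf : ⨅ y, (I y : EReal) ≤ 0 := by
    have := h.upper_bound Set.univ isClosed_univ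
    rw [limsup_congr hlog, limsup_const] at this
    simpa using EReal.neg_le_neg_iff.2 this
  obtain ⟨y, hy⟩ : ∃ y, (I y : EReal) < 1 := iInf_lt_iff.1 (hinf.trans_lt zero_lt_one)
  have hy1 : I y ≤ (1 : ℝ≥0) := by exact_mod_cast hy.le
  obtain ⟨z, hz1, hz⟩ := (h.lowerSemicontinuous.lowerSemicontinuousOn _).exists_isMinOn
    ⟨y, hy1⟩ (h.isCompact_sublevel 1)
  have hmin (y : 𝒳) : I z ≤ I y := (le_total (I y) (1 : ℝ≥0)).elim (hz ·) (hz1.trans ·)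
  have : (I z : EReal) ≤ 0 :=
    (le_iInf fun y => EReal.coe_ennreal_le_coe_ennreal_iff.2 (hmin y)).trans hinf
  exact ⟨z, by exact_mod_cast this.antisymm (EReal.coe_ennreal_nonneg _)⟩

variable [OpensMeasurableSpace 𝒳]

lemma GibbsLDP.measure_inter_ne_zero (h : GibbsLDP γ I) {U : Set 𝒳} (hU : IsOpen U) {x : 𝒳}
    (hx : x ∈ U) (hIx : I x < ∞) : γ (U ∩ {y | I y < ∞}) ≠ 0 := by
  intro hγ
  have hlog : (fun ε : ℝ => (ε : EReal) *
      ENNReal.log (gibbsMeasure γ I (ENNReal.ofReal ε) U)) =ᶠ[𝓝[>] 0] fun _ => ⊥ := by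
    filter_upwards [self_mem_nhdsWithin] with ε hε
    have hzero : γ.withDensity (fun y => expNeg (I y / ENNReal.ofReal ε)) U = 0 := by
      rw [withDensity_apply_eq_zero'
        (measurable_expNeg_div h.ldp.lowerSemicontinuous.measurable _).aemeasurable]
      refine measure_mono_null ?_ hγ
      rintro y ⟨hy, hyU⟩
      refine ⟨hyU, show I y < ∞ from Ne.lt_top fun hI => hy ?_⟩
      simp [hI, ENNReal.top_div_of_ne_top]
    rw [gibbsMeasure, Measure.smul_apply, hzero, smul_zero, ENNReal.log_zero,
      EReal.coe_mul_bot_of_pos hε]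
  have hlower := h.ldp.lower_bound U hU
  rw [liminf_congr hlog, liminf_const, le_bot_iff, EReal.neg_eq_bot_iff] at hlower
  have hle : (⨅ y ∈ U, (I y : EReal)) ≤ I x := iInf₂_le x hx
  rw [hlower, top_le_iff, EReal.coe_ennreal_eq_top_iff] at hle
  exact hIx.ne hle

lemma GibbsLDP.measure_ne_zero_of_mem_nhdsWithin (h : GibbsLDP γ I) {x : 𝒳} (hIx : I x < ∞)
    {s : Set 𝒳} (hs : s ∈ 𝓝[{y | I y < ∞}] x) : γ s ≠ 0 := by
  obtain ⟨U, hU, hxU, hsub⟩ := mem_nhdsWithin.1 hs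
  exact fun h0 => h.measure_inter_ne_zero hU hxU hIx (measure_mono_null hsub h0)

lemma GibbsLDP.exists_inv_partitionFunction_le (h : GibbsLDP γ I)
    (hI : ContinuousOn I {y | I y < ∞}) (a : ℝ≥0) {d : ℝ} (hd : 0 < d) :
    ∃ C ≠ ∞, ∀ ε : ℝ, 0 < ε →
      (partitionFunction γ I (ENNReal.ofReal ε / a))⁻¹ ≤ C * boltzmann ε (-d) := by
  obtain ⟨z, hz⟩ := h.ldp.exists_eq_zero <| by
    filter_upwards [self_mem_nhdsWithin] with ε hε using h.isProbabilityMeasure ε hε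
  have hzfin : I z < ∞ := by simp [hz]
  let A := {y | a * I y ≤ ENNReal.ofReal d}
  have hA : MeasurableSet A :=
    (h.ldp.lowerSemicontinuous.measurable.const_mul _) measurableSet_Iic
  have hγA : γ A ≠ 0 := by
    refine h.measure_ne_zero_of_mem_nhdsWithin hzfin ?_
    have hlim : Tendsto (fun y => a * I y) (𝓝[{y | I y < ∞}] z) (𝓝 (a * I z)) :=
      ENNReal.Tendsto.const_mul (hI z hzfin) (.inr ENNReal.coe_ne_top)
    exact (hlim.eventually_lt_const (by simpa [hz] using hd)).mono fun _ => le_of_lt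
  refine ⟨(γ A)⁻¹, ENNReal.inv_ne_top.2 hγA, fun ε hε => ?_⟩
  have hle : boltzmann ε d * γ A ≤ partitionFunction γ I (ENNReal.ofReal ε / a) := by
    rw [← ENNReal.toReal_ofReal hd.le, ← expNeg_div_ofReal hε ENNReal.ofReal_ne_top]
    refine le_partitionFunction hA fun y hy => ?_
    rw [div_div_coe (by simpa using hε)]
    exact ENNReal.div_le_div_right hy _
  rw [boltzmann_neg, mul_comm, ← ENNReal.mul_inv (.inl (boltzmann_ne_zero ε d))
    (.inl (boltzmann_ne_top ε d))]
  exact ENNReal.inv_le_inv.2 hle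

end LargeDeviations

section Replicas

variable {K : ℕ} {𝒳 : Type*} [MeasurableSpace 𝒳] {γ : Measure 𝒳} {I : 𝒳 → ℝ≥0∞} {F : 𝒳 → ℝ}
  {α : Fin K → ℝ≥0} {ε : ℝ}

/-- The joint law of independent replicas at the temperatures `ε / α j` (`∞` if `α j = 0`), under
which the moments of the estimator are computed. -/
noncomputable def replicaMeasure (γ : Measure 𝒳) (I : 𝒳 → ℝ≥0∞) (α : Fin K → ℝ≥0) (ε : ℝ) :
    Measure (Fin K → 𝒳) :=
  Measure.pi fun j => gibbsMeasure γ I (ENNReal.ofReal ε / α j)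

lemma measurable_energy (hI : Measurable I) (α : Fin K → ℝ≥0) : Measurable (energy I α) :=
  Finset.measurable_fun_sum _ fun j _ => (hI.comp (measurable_pi_apply j)).const_mul _

lemma measurable_estimator [NeZero K] (hI : Measurable I) (hF : Measurable F) (α : Fin K → ℝ≥0)
    (ε : ℝ) : Measurable (estimator I F α ε) := by
  have hperm (σ : Equiv.Perm (Fin K)) : Measurable fun (x : Fin K → 𝒳) j => x (σ j) := by fun_prop
  have hexp : Measurable fun x => expNeg (energy I α x / ENNReal.ofReal ε) :=
    measurable_expNeg_div (measurable_energy hI α) _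
  have hweight : Measurable (weight I α ε) :=
    hexp.div (Finset.measurable_fun_sum _ fun τ _ => hexp.comp (hperm τ))
  exact Finset.measurable_fun_sum _ fun σ _ => (hweight.comp (hperm σ)).mul (by fun_prop)

lemma lintegral_pi_prod {ι : Type*} [Fintype ι] {𝒴 : ι → Type*} [∀ i, MeasurableSpace (𝒴 i)]
    (ν : ∀ i, Measure (𝒴 i)) [∀ i, IsProbabilityMeasure (ν i)] {g : ∀ i, 𝒴 i → ℝ≥0∞}
    (hg : ∀ i, Measurable (g i)) :
    ∫⁻ y, ∏ i, g i (y i) ∂Measure.pi ν = ∏ i, ∫⁻ t, g i t ∂ν i := by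
  rw [lintegral_prod_eq_prod_lintegral_of_indepFun _ _
    (iIndepFun_pi fun i => (hg i).aemeasurable) fun i => (hg i).comp (measurable_pi_apply i)]
  exact Finset.prod_congr rfl fun i _ =>
    (measurePreserving_eval ν i).lintegral_comp (hg i)

section UpperBound

variable [NeZero K]

lemma lintegral_estimator_sq_le
    [∀ j, IsProbabilityMeasure (gibbsMeasure γ I (ENNReal.ofReal ε / α j))] {v m : ℝ} {κ θ : ℝ≥0}
    (hI : Measurable I) (hε : 0 < ε) (hα : α 0 ≠ 0) (hv : v ≤ decayRate I F α)
    (hm : ∀ y, m ≤ F y) (hκ : κ ≠ 0) (hκθ : κ + θ = 1) :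
    ∫⁻ x, estimator I F α ε x ^ 2 ∂replicaMeasure γ I α ε
      ≤ K.factorial ^ 2 * boltzmann ε (κ * v + 2 * θ * m)
        * ∏ j, ((partitionFunction γ I (ENNReal.ofReal ε / α j))⁻¹
          * partitionFunction γ I (ENNReal.ofReal ε / α j / θ)) := by
  have hmeas (j : Fin K) :
      Measurable fun y => (expNeg (κ * (I y / (ENNReal.ofReal ε / α j))))⁻¹ :=
    (measurable_expNeg.comp ((hI.div_const _).const_mul _)).inv
  have hprod : Measurable fun x : Fin K → 𝒳 =>
      ∏ j, (expNeg (κ * (I (x j) / (ENNReal.ofReal ε / α j))))⁻¹ :=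
    Finset.measurable_fun_prod _ fun j _ => (hmeas j).comp (measurable_pi_apply j)
  have hT (j : Fin K) : ENNReal.ofReal ε / α j ≠ 0 := by simp [ENNReal.div_eq_zero_iff, hε]
  refine (lintegral_mono fun x => estimator_sq_le_prod hε hα hv hm hκ hκθ x).trans ?_
  rw [lintegral_const_mul _ hprod, replicaMeasure, lintegral_pi_prod _ hmeas]
  gcongr with j
  exact lintegral_inv_expNeg_gibbsMeasure_le hI (hT j) hκθ

lemma exists_lt_convex_combination {r v : ℝ} (hrv : r < v) (w : ℝ) :
    ∃ κ θ : ℝ≥0, κ ≠ 0 ∧ θ ≠ 0 ∧ κ + θ = 1 ∧ r < κ * v + θ * w := by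
  have hcont : ContinuousAt (fun θ : ℝ => (1 - θ) * v + θ * w) 0 := by fun_prop
  have hnear : ∀ᶠ θ : ℝ in 𝓝[>] 0, r < (1 - θ) * v + θ * w :=
    (hcont.eventually_const_lt (by simpa using hrv)).filter_mono nhdsWithin_le_nhds
  obtain ⟨θ, hθ, hθ0, hθ1⟩ := (hnear.and (Ioo_mem_nhdsGT one_pos)).exists
  lift θ to ℝ≥0 using hθ0.le
  have hθ1' : θ < 1 := by exact_mod_cast hθ1
  refine ⟨1 - θ, θ, (tsub_pos_of_lt hθ1').ne', (NNReal.coe_pos.1 hθ0).ne',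
    tsub_add_cancel_of_le hθ1'.le, ?_⟩
  rwa [NNReal.coe_sub hθ1'.le, NNReal.coe_one]

variable [TopologicalSpace 𝒳] [T2Space 𝒳] [OpensMeasurableSpace 𝒳]

lemma GibbsLDP.exists_prod_partitionFunction_le (h : GibbsLDP γ I)
    (hI : ContinuousOn I {y | I y < ∞})
    (hprob : ∀ ε : ℝ, 0 < ε →
      ∀ j, IsProbabilityMeasure (gibbsMeasure γ I (ENNReal.ofReal ε / α j)))
    {θ : ℝ≥0} (hθ : θ ≠ 0) {d : ℝ} (hd : 0 < d) :
    ∃ C ≠ ∞, ∀ᶠ ε in 𝓝[>] 0,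
      ∏ j, ((partitionFunction γ I (ENNReal.ofReal ε / α j))⁻¹
          * partitionFunction γ I (ENNReal.ofReal ε / α j / θ)) ≤ C * boltzmann ε (-d) := by
  have hdK : 0 < d / K := div_pos hd (by exact_mod_cast NeZero.pos K)
  choose C hC hCle using fun j => h.exists_inv_partitionFunction_le hI (α j) hdK
  let D (j : Fin K) : ℝ≥0∞ := partitionFunction γ I (ENNReal.ofReal (1 / θ) / α j)
  have hD (j : Fin K) : D j ≠ ∞ := by
    have := hprob (1 / θ) (by positivity) j
    exact partitionFunction_ne_top
  refine ⟨∏ j, C j * D j, ENNReal.prod_ne_top fun j _ => ENNReal.mul_ne_top (hC j) (hD j), ?_⟩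
  filter_upwards [Ioc_mem_nhdsGT one_pos] with ε ⟨hε, hε1⟩
  have hDle (j : Fin K) : partitionFunction γ I (ENNReal.ofReal ε / α j / θ) ≤ D j := by
    refine partitionFunction_mono ?_
    rw [ENNReal.div_right_comm, ← ENNReal.ofReal_coe_nnreal (p := θ),
      ← ENNReal.ofReal_div_of_pos (by positivity)]
    gcongr
  calc _
    _ ≤ ∏ j, C j * boltzmann ε (-(d / K)) * D j :=
        Finset.prod_le_prod' fun j _ => mul_le_mul' (hCle j ε hε) (hDle j)
    _ = (∏ j, C j * D j) * boltzmann ε (-d) := by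
        simp only [Finset.prod_mul_distrib, Finset.prod_const, Finset.card_univ, Fintype.card_fin,
          boltzmann_pow]
        rw [mul_neg, mul_div_cancel₀ _ (NeZero.ne (K : ℝ)), mul_right_comm]

theorem GibbsLDP.exists_lintegral_estimator_sq_le (h : GibbsLDP γ I)
    (hI : ContinuousOn I {y | I y < ∞}) (hFb : BddBelow (Set.range F)) (hα : α 0 ≠ 0)
    (hprob : ∀ ε : ℝ, 0 < ε →
      ∀ j, IsProbabilityMeasure (gibbsMeasure γ I (ENNReal.ofReal ε / α j)))
    {r : ℝ} (hr : r < decayRate I F α) :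
    ∃ C ≠ ∞, ∀ᶠ ε in 𝓝[>] 0,
      ∫⁻ x, estimator I F α ε x ^ 2 ∂replicaMeasure γ I α ε ≤ C * boltzmann ε r := by
  obtain ⟨m, hm⟩ := hFb
  obtain ⟨v, hrv, hv⟩ := EReal.exists_between_coe_real hr
  obtain ⟨κ, θ, hκ, hθ, hκθ, hlt⟩ :=
    exists_lt_convex_combination (EReal.coe_lt_coe_iff.1 hrv) (2 * m)
  obtain ⟨C, hC, hCle⟩ :=
    h.exists_prod_partitionFunction_le hI hprob hθ (sub_pos.2 hlt)
  refine ⟨K.factorial ^ 2 * C,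
    ENNReal.mul_ne_top (ENNReal.pow_ne_top (ENNReal.natCast_ne_top _)) hC, ?_⟩
  filter_upwards [hCle, self_mem_nhdsWithin] with ε hCε hε
  have := hprob ε hε
  refine (lintegral_estimator_sq_le h.ldp.lowerSemicontinuous.measurable hε hα hv.le
    (fun y => hm ⟨y, rfl⟩) hκ hκθ).trans ?_
  calc _
    _ ≤ K.factorial ^ 2 * boltzmann ε (κ * v + 2 * θ * m)
          * (C * boltzmann ε (-(κ * v + θ * (2 * m) - r))) := by gcongr
    _ = K.factorial ^ 2 * C
          * (boltzmann ε (κ * v + 2 * θ * m) * boltzmann ε (-(κ * v + θ * (2 * m) - r))) := by ring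
    _ = K.factorial ^ 2 * C * boltzmann ε r := by
        rw [← boltzmann_add]
        congr 2
        ring

end UpperBound

section LowerBound

variable {d : ℝ≥0}

lemma measurableSet_levelNeighborhood (hI : Measurable I) (hF : Measurable F) (d : ℝ≥0) (a : 𝒳) :
    MeasurableSet (levelNeighborhood I F d a) :=
  (measurableSet_le measurable_const (hI.add_const _)).inter
    ((measurableSet_le hI measurable_const).inter (measurableSet_le hF measurable_const))

lemma le_replicaMeasure_pi [∀ j, SigmaFinite (gibbsMeasure γ I (ENNReal.ofReal ε / α j))]
    (hI : Measurable I) (hF : Measurable F) (hε : 0 < ε) {x : Fin K → 𝒳}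
    (hx : energy I α x ≠ ∞) :
    boltzmann ε ((energy I α x).toReal + (∑ j, α j) * d)
        * ∏ j, ((partitionFunction γ I (ENNReal.ofReal ε / α j))⁻¹
          * γ (levelNeighborhood I F d (x j)))
      ≤ replicaMeasure γ I α ε (Set.univ.pi fun j => levelNeighborhood I F d (x j)) := by
  have hexp : boltzmann ε ((energy I α x).toReal + (∑ j, α j) * d)
      = ∏ j, expNeg ((I (x j) + d) / (ENNReal.ofReal ε / α j)) := by
    rw [← expNeg_sum, ← energy_div_ofReal hε fun y => I y + d, energy_add_const,
      expNeg_div_ofReal hε (ENNReal.add_ne_top.2 ⟨hx, ENNReal.coe_ne_top⟩),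
      ENNReal.toReal_add hx ENNReal.coe_ne_top, ENNReal.coe_toReal]
    push_cast
    rfl
  rw [hexp, ← Finset.prod_mul_distrib, replicaMeasure, Measure.pi_pi]
  exact Finset.prod_le_prod' fun j _ => le_gibbsMeasure
    (measurableSet_levelNeighborhood hI hF d _) fun y hy => ENNReal.div_le_div_right hy.2.1 _

variable [NeZero K]

lemma le_lintegral_estimator_sq [∀ j, SigmaFinite (gibbsMeasure γ I (ENNReal.ofReal ε / α j))]
    (hI : Measurable I) (hF : Measurable F) (hε : 0 < ε) {x : Fin K → 𝒳}
    (hx : energy I α x ≠ ∞) {τ : Equiv.Perm (Fin K)}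
    (hτ : energy I α (x ∘ τ) = minEnergy I α x) :
    ((K.factorial : ℝ≥0∞)⁻¹ ^ 2 * ∏ j, ((partitionFunction γ I (ENNReal.ofReal ε / α j))⁻¹
          * γ (levelNeighborhood I F d (x (τ j)))))
        * boltzmann ε (cost I F α x + (5 * ∑ j, α j + 2) * d)
      ≤ ∫⁻ y, estimator I F α ε y ^ 2 ∂replicaMeasure γ I α ε := by
  set s : ℝ := (energy I α x).toReal - (minEnergy I α x).toReal + F (x 0)
    + (2 * ∑ j, α j + 1) * d with hs
  let B : Set (Fin K → 𝒳) := Set.univ.pi fun j => levelNeighborhood I F d (x (τ j))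
  have hB : MeasurableSet B :=
    .univ_pi fun j => measurableSet_levelNeighborhood hI hF d _
  have hest (y : Fin K → 𝒳) (hy : y ∈ B) :
      (K.factorial : ℝ≥0∞)⁻¹ * boltzmann ε s ≤ estimator I F α ε y := by
    rw [← estimator_comp_perm I F α ε y τ.symm]
    exact le_estimator_of_mem_levelNeighborhood hε hx fun j => by
      simpa using hy (τ.symm j) trivial
  have hminfin : energy I α (x ∘ τ) ≠ ∞ := hτ ▸ ne_top_of_le_ne_top hx (minEnergy_le_energy I α x)
  have hexp : 2 * s + ((energy I α (x ∘ τ)).toReal + (∑ j, α j) * d)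
      = cost I F α x + (5 * ∑ j, α j + 2) * d := by
    rw [hτ, hs, cost]
    ring
  calc _
    _ = ((K.factorial : ℝ≥0∞)⁻¹ * boltzmann ε s) ^ 2
          * (boltzmann ε ((energy I α (x ∘ τ)).toReal + (∑ j, α j) * d)
            * ∏ j, ((partitionFunction γ I (ENNReal.ofReal ε / α j))⁻¹
              * γ (levelNeighborhood I F d (x (τ j))))) := by
        rw [← hexp, boltzmann_add, mul_pow, boltzmann_pow]
        push_cast
        ring
    _ ≤ ((K.factorial : ℝ≥0∞)⁻¹ * boltzmann ε s) ^ 2 * replicaMeasure γ I α ε B := by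
        gcongr
        exact le_replicaMeasure_pi hI hF hε hminfin
    _ ≤ ∫⁻ y in B, estimator I F α ε y ^ 2 ∂replicaMeasure γ I α ε := by
        rw [← setLIntegral_const]
        exact setLIntegral_mono' hB fun y hy => pow_le_pow_left' (hest y hy) 2
    _ ≤ ∫⁻ y, estimator I F α ε y ^ 2 ∂replicaMeasure γ I α ε := setLIntegral_le_lintegral _ _

variable [TopologicalSpace 𝒳] [T2Space 𝒳] [OpensMeasurableSpace 𝒳]

lemma GibbsLDP.measure_levelNeighborhood_ne_zero (h : GibbsLDP γ I)
    (hI : ContinuousOn I {y | I y < ∞}) (hF : Continuous F) (hd : 0 < d) {a : 𝒳}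
    (ha : I a < ∞) : γ (levelNeighborhood I F d a) ≠ 0 := by
  have hd' : (d : ℝ≥0∞) ≠ 0 := by exact_mod_cast hd.ne'
  have hIa : ContinuousWithinAt I {y | I y < ∞} a := hI a ha
  refine h.measure_ne_zero_of_mem_nhdsWithin ha ?_
  filter_upwards [hIa.eventually_lt_const (ENNReal.lt_add_right ha.ne hd'),
    (hIa.add continuousWithinAt_const).eventually_const_lt (ENNReal.lt_add_right ha.ne hd'),
    hF.continuousWithinAt.eventually_lt_const (lt_add_of_pos_right (F a) (NNReal.coe_pos.2 hd))]
    with y hle hge hFy using ⟨hge.le, hle.le, hFy.le⟩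

theorem GibbsLDP.exists_le_lintegral_estimator_sq (h : GibbsLDP γ I)
    (hI : ContinuousOn I {y | I y < ∞}) (hF : Continuous F)
    (hprob : ∀ ε : ℝ, 0 < ε →
      ∀ j, IsProbabilityMeasure (gibbsMeasure γ I (ENNReal.ofReal ε / α j)))
    {r : ℝ} (hr : decayRate I F α < r) :
    ∃ c ≠ 0, ∀ᶠ ε in 𝓝[>] 0,
      c * boltzmann ε r ≤ ∫⁻ x, estimator I F α ε x ^ 2 ∂replicaMeasure γ I α ε := by
  obtain ⟨z, hz⟩ := h.ldp.exists_eq_zero <| by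
    filter_upwards [self_mem_nhdsWithin] with ε hε using h.isProbabilityMeasure ε hε
  obtain ⟨x, hx, hxr⟩ := exists_cost_lt hz hr
  obtain ⟨τ, hτ⟩ := exists_energy_comp_eq_minEnergy I α x
  obtain ⟨d, hd, hdr⟩ : ∃ d : ℝ≥0, 0 < d ∧ cost I F α x + (5 * ∑ j, α j + 2) * d ≤ r := by
    have hS : (0 : ℝ) < 5 * ∑ j, α j + 2 := by positivity
    refine ⟨((r - cost I F α x) / (5 * ∑ j, α j + 2)).toNNReal,
      Real.toNNReal_pos.2 (div_pos (sub_pos.2 hxr) hS), ?_⟩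
    rw [Real.coe_toNNReal _ (div_pos (sub_pos.2 hxr) hS).le, mul_div_cancel₀ _ hS.ne',
      add_sub_cancel]
  refine ⟨(K.factorial : ℝ≥0∞)⁻¹ ^ 2 * ∏ j, ((partitionFunction γ I (ENNReal.ofReal 1 / α j))⁻¹
    * γ (levelNeighborhood I F d (x (τ j)))), ?_, ?_⟩
  · refine mul_ne_zero (pow_ne_zero 2 (ENNReal.inv_ne_zero.2 (ENNReal.natCast_ne_top _)))
      (Finset.prod_ne_zero_iff.2 fun j _ => mul_ne_zero ?_
        (h.measure_levelNeighborhood_ne_zero hI hF hd (hx (τ j)).lt_top))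
    have := hprob 1 one_pos j
    exact ENNReal.inv_ne_zero.2 partitionFunction_ne_top
  · filter_upwards [Ioc_mem_nhdsGT one_pos] with ε ⟨hε, hε1⟩
    have := hprob ε hε
    refine le_trans ?_ (le_lintegral_estimator_sq (d := d)
      h.ldp.lowerSemicontinuous.measurable hF.measurable hε (energy_ne_top hx) hτ)
    gcongr with j
    · exact partitionFunction_mono (ENNReal.div_le_div_right (ENNReal.ofReal_le_ofReal hε1) _)
    · exact boltzmann_antitone hε.le hdr

end LowerBound

end Replicas

end INS

theorem theorem1_general {𝒳 : Type*} [TopologicalSpace 𝒳] [T2Space 𝒳]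
    [MeasurableSpace 𝒳] [OpensMeasurableSpace 𝒳]
    (γ : Measure 𝒳) (I : 𝒳 → ℝ≥0∞) (hμ : INS.GibbsLDP γ I)
    (hI : ContinuousOn I {x | I x < ∞})
    (F : 𝒳 → ℝ) (hF : Continuous F) (hFb : BddBelow (Set.range F))
    (K : ℕ) [NeZero K] (α : Fin K → ℝ≥0) (hα : α 0 ≠ 0)
    {Ω : ℝ → Type*} [∀ ε, MeasurableSpace (Ω ε)]
    (P : ∀ ε, Measure (Ω ε)) [∀ ε, IsProbabilityMeasure (P ε)]
    (X : ∀ ε, Fin K → Ω ε → 𝒳)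
    (hindep : ∀ ε : ℝ, 0 < ε → iIndepFun (X ε) (P ε))
    (hlaw : ∀ ε : ℝ, 0 < ε → ∀ j,
      HasLaw (X ε j) (INS.gibbsMeasure γ I (ENNReal.ofReal ε / (α j : ℝ≥0∞))) (P ε)) :
    Tendsto
      (fun ε : ℝ => -(ε : EReal) *
        ENNReal.log (∫⁻ ω, (INS.estimator I F α ε (fun j => X ε j ω)) ^ 2 ∂(P ε)))
      (𝓝[>] 0) (𝓝 (INS.decayRate I F α)) := by
  have hprob (ε : ℝ) (hε : 0 < ε) (j : Fin K) :
      IsProbabilityMeasure (INS.gibbsMeasure γ I (ENNReal.ofReal ε / α j)) :=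
    (hlaw ε hε j).isProbabilityMeasure_iff.1 inferInstance
  have hmoment (ε : ℝ) (hε : 0 < ε) :
      ∫⁻ ω, INS.estimator I F α ε (fun j => X ε j ω) ^ 2 ∂P ε
        = ∫⁻ x, INS.estimator I F α ε x ^ 2 ∂INS.replicaMeasure γ I α ε := by
    have := hprob ε hε
    have hmeas := INS.measurable_estimator hμ.ldp.lowerSemicontinuous.measurable hF.measurable α ε
    exact ((hindep ε hε).hasLaw_pi (hlaw ε hε)).lintegral_comp (hmeas.pow_const 2).aemeasurable
  refine (INS.tendsto_neg_mul_log
    (fun r => hμ.exists_lintegral_estimator_sq_le hI hFb hα hprob)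
    (fun r => hμ.exists_le_lintegral_estimator_sq hI hF hprob)).congr' ?_
  filter_upwards [self_mem_nhdsWithin] with ε hε
  rw [hmoment ε hε]

theorem theorem1 {𝒳 : Type*} [TopologicalSpace 𝒳] [PolishSpace 𝒳]
    [MeasurableSpace 𝒳] [BorelSpace 𝒳]
    (γ : Measure 𝒳) (I : 𝒳 → ℝ≥0∞) (hμ : INS.GibbsLDP γ I)
    (hI : ContinuousOn I {x | I x < ∞})
    (F : 𝒳 → ℝ) (hF : Continuous F) (hFb : BddBelow (Set.range F))
    (K : ℕ) [NeZero K] (α : Fin K → ℝ≥0) (hα1 : α 0 = 1) (hα : Antitone α)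
    {Ω : ℝ → Type*} [∀ ε, MeasurableSpace (Ω ε)]
    (P : ∀ ε, Measure (Ω ε)) [∀ ε, IsProbabilityMeasure (P ε)]
    (X : ∀ ε, Fin K → Ω ε → 𝒳)
    (hindep : ∀ ε : ℝ, 0 < ε → iIndepFun (X ε) (P ε))
    (hlaw : ∀ ε : ℝ, 0 < ε → ∀ j,
      HasLaw (X ε j) (INS.gibbsMeasure γ I (ENNReal.ofReal ε / (α j : ℝ≥0∞))) (P ε)) :
    Tendsto
      (fun ε : ℝ => -(ε : EReal) *
        ENNReal.log (∫⁻ ω, (INS.estimator I F α ε (fun j => X ε j ω)) ^ 2 ∂(P ε)))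
      (𝓝[>] 0) (𝓝 (INS.decayRate I F α)) := by
  exact theorem1_general γ I hμ hI F hF hFb K α (by simp [hα1]) P X hindep hlaw
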